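/- Fix integers $T\ge 2$ and $r$, and a fast matrix multiplication algorithm for $T\times T$ matrices with $r$ multiplications: that is, expressions $M_1,\dots,M_r$, each the product of a $\{-1,1\}$-weighted sum of some of the entries of $A$ with a $\{-1,1\}$-weighted sum of some of the entries of $B$, such that every entry of $AB$ is a fixed $\{-1,1\}$-weighted sum of some of the $M_i$, for all $T\times T$ integer matrices $A,B$. Put $\omega=\log_T r$. A threshold gate with binary inputs $y_1,\dots,y_n$ outputs $1$ if and only if $\sum_i w_iy_i\ge t$, where the $w_i$ and $t$ are fixed integers. A threshold circuit is an acyclic circuit of such gates with unbounded fan-in. Its size is its number of gates, and its depth is the maximum number of gates on a directed path ending at an output node. An integer $z$ is said to be given with $b$ bits if it is given by the binary digits of two nonnegative integers $z^+,z^-<2^b$ with $z=z^+-z^-$. Theorem. For every real $c$ there are constants $K$ and $k$, depending only on the algorithm and on $c$, such that the following holds for all positive integers $d$ and $l$, with $N=T^l$, and every integer $0\le b\le c\log N$. There is a threshold circuit of depth at most $K\,d$ with at most $$K\,(\log N)^k\, d\,N^{\omega+1/d}$$ gates which, for all $N\times N$ integer matrices $A$ and $B$ whose entries are given with $b$ bits,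 computes the matrix product $AB$, its entries being given with $m$ bits for some $m\le K\log N$. In short: for integer matrices with $O(\log N)$-bit entries there is a threshold circuit of depth $O(d)$ that computes $AB$ with $\widetilde O(d\,N^{\omega+1/d})$ gates. -/

import Mathlib

/-- A fast matrix multiplication algorithm: a bilinear scheme that multiplies two `T × T` matrices
with `r` multiplications. The `i`-th multiplication `M i` is the product of a `{-1, 1}`-weighted sum
of entries (blocks) of `A` with a `{-1, 1}`-weighted sum of entries (blocks) of `B`, and every entry
(block) of `A * B` is a `{-1, 1}`-weighted sum of the `M i`. The weight `0` says that a term does not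
appear. Correctness is asked for integer entries; being an identity of bilinear forms, it is
then valid for matrices partitioned into `T × T` blocks as well. -/
structure FastMatMulAlgorithm (T r : ℕ) where
  /-- the weights of the entries of `A` in the first factor of the `i`-th multiplication -/
  weightA : Fin r → Fin T → Fin T → ℤ
  /-- the weights of the entries of `B` in the second factor of the `i`-th multiplication -/
  weightB : Fin r → Fin T → Fin T → ℤ
  /-- the weight of the `i`-th multiplication in the expression for an entry of the product -/
  weightC : Fin T → Fin T → Fin r → ℤ
  weightA_mem : ∀ i p q, weightA i p q ∈ ({-1, 0, 1} : Set ℤ)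
  weightB_mem : ∀ i p q, weightB i p q ∈ ({-1, 0, 1} : Set ℤ)
  weightC_mem : ∀ p q i, weightC p q i ∈ ({-1, 0, 1} : Set ℤ)
  correct : ∀ (A B : Matrix (Fin T) (Fin T) ℤ) (p q : Fin T),
    (A * B) p q = ∑ i, weightC p q i *
      ((∑ j, ∑ k, weightA i j k * A j k) * (∑ j, ∑ k, weightB i j k * B j k))

namespace FastMatMulAlgorithm

/-- The exponent `ω = log_T r` of the recursive algorithm, which multiplies two `N × N` matrices,
`N = T ^ l`, with `r ^ l = N ^ ω` scalar multiplications. -/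
noncomputable def exponent {T r : ℕ} (_alg : FastMatMulAlgorithm T r) : ℝ :=
  Real.logb T r

end FastMatMulAlgorithm

/-- A Boolean circuit of threshold gates with unbounded fan-in, with input nodes indexed by `ι` and
output positions indexed by `κ`. The gate `g` outputs `1` if and only if the weighted sum of the
inputs and gates feeding it is at least `threshold g`. There is a wire into `g` exactly from those
inputs and gates that have a nonzero weight at `g`, and the wires form no cycle. -/
structure ThresholdCircuit (ι κ : Type) where
  Gate : Type
  gateFintype : Fintype Gate
  inputWeight : Gate → ι → ℤ
  gateWeight : Gate → Gate → ℤ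
  threshold : Gate → ℤ
  wellFounded : WellFounded (fun h g : Gate => gateWeight g h ≠ 0)
  /-- the node (an input node or a gate) that is read at an output position -/
  output : κ → ι ⊕ Gate

namespace ThresholdCircuit

attribute [instance] ThresholdCircuit.gateFintype

variable {ι κ : Type}

/-- The size of the circuit: its number of gates. -/
def size (C : ThresholdCircuit ι κ) : ℕ :=
  Fintype.card C.Gate

open Classical in
/-- The bit computed by a gate on the input `x`. -/
noncomputable def gateValue [Fintype ι] (C : ThresholdCircuit ι κ) (x : ι → Bool) :
    C.Gate → Bool :=
  C.wellFounded.fix fun g value =>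
    decide (C.threshold g ≤
      (∑ i, if x i = true then C.inputWeight g i else 0) +
      ∑ h, if hw : C.gateWeight g h ≠ 0 then
        (if value h hw = true then C.gateWeight g h else 0) else 0)

/-- The gate equation: a gate fires if and only if the weighted sum of the values of its
inputs reaches its threshold. -/
theorem gateValue_eq_true_iff [Fintype ι] (C : ThresholdCircuit ι κ) (x : ι → Bool)
    (g : C.Gate) :
    C.gateValue x g = true ↔
      C.threshold g ≤ (∑ i, if x i = true then C.inputWeight g i else 0) +
        ∑ h, if C.gateValue x h = true then C.gateWeight g h else 0 := by
  classical
  have key : ∀ h, (if _hw : C.gateWeight g h ≠ 0 then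
      (if C.gateValue x h = true then C.gateWeight g h else 0) else 0) =
      if C.gateValue x h = true then C.gateWeight g h else 0 := by
    intro h
    by_cases hw : C.gateWeight g h = 0 <;> simp [hw]
  rw [gateValue, WellFounded.fix_eq, decide_eq_true_eq]
  change _ ≤ _ + (∑ h, if _hw : C.gateWeight g h ≠ 0 then
      (if C.gateValue x h = true then C.gateWeight g h else 0) else 0) ↔ _
  rw [Finset.sum_congr rfl fun h _ => key h]
  rfl

/-- The output of the circuit on the input `x`. -/
noncomputable def eval [Fintype ι] (C : ThresholdCircuit ι κ) (x : ι → Bool) : κ → Bool :=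
  fun k => Sum.elim x (C.gateValue x) (C.output k)

open Classical in
/-- The depth of a gate: one more than the largest depth of a gate that feeds it, and `1` for a gate
that is fed by no other gate (input nodes have depth `0`). -/
noncomputable def gateDepth (C : ThresholdCircuit ι κ) : C.Gate → ℕ :=
  C.wellFounded.fix fun g depth =>
    1 + Finset.univ.sup fun h =>
      if hw : C.gateWeight g h ≠ 0 then depth h hw else 0

open Classical in
/-- The recursive equation for the depth of a gate. -/
theorem gateDepth_eq (C : ThresholdCircuit ι κ) (g : C.Gate) :
    C.gateDepth g =
      1 + Finset.univ.sup fun h => if C.gateWeight g h ≠ 0 then C.gateDepth h else 0 := by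
  rw [gateDepth, WellFounded.fix_eq]
  rfl

/-- The depth of the circuit: the length of a longest directed path to an output node. -/
noncomputable def depth [Fintype κ] (C : ThresholdCircuit ι κ) : ℕ :=
  Finset.univ.sup fun k => Sum.elim (fun _ => 0) C.gateDepth (C.output k)

end ThresholdCircuit

/-- The positions of the bits of an `N × N` integer matrix with `b`-bit entries. An entry `z` is
given as `z = z⁺ - z⁻`, where `z⁺` and `z⁻` are nonnegative integers of at most `b` bits. The
position `(i, j, s, k)` is that of the bit of weight `2 ^ k` of `z⁺` (if `s = true`) or of `z⁻`
(if `s = false`), where `z` is the entry in row `i` and column `j`. -/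
abbrev MatrixBits (N b : ℕ) : Type :=
  Fin N × Fin N × Bool × Fin b

/-- The nonnegative integer with the binary digits `x`, least significant first. -/
def natOfBits {b : ℕ} (x : Fin b → Bool) : ℕ :=
  ∑ k, (x k).toNat * 2 ^ (k : ℕ)

/-- The integer matrix with the given bits. -/
def matrixOfBits {N b : ℕ} (x : MatrixBits N b → Bool) : Matrix (Fin N) (Fin N) ℤ :=
  Matrix.of fun i j =>
    (natOfBits fun k => x (i, j, true, k) : ℤ) - (natOfBits fun k => x (i, j, false, k) : ℤ)

/-- The circuit computes, from the bits of two `N × N` integer matrices with `b`-bit entries, the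
bits of their product, whose entries are given by `m`-bit numbers. -/
def ThresholdCircuit.ComputesMatrixProduct {N b m : ℕ}
    (C : ThresholdCircuit (MatrixBits N b ⊕ MatrixBits N b) (MatrixBits N m)) : Prop :=
  ∀ x y : MatrixBits N b → Bool,
    matrixOfBits (C.eval (Sum.elim x y)) = matrixOfBits x * matrixOfBits y

/-! Unrolling all `l` levels of the recursion gives a single bilinear scheme with `r ^ l = N ^ ω`
multiplications and weights in `{-1, 0, 1}` (`mul_apply_eq_sum_powWeight`). As fan-in and weights
are unrestricted, each factor is one linear form in the input bits. Expanding the product of two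
factors digit by digit, each entry of the result is one linear form in conjunctions of digit pairs.
The circuit is therefore: linear forms, conjunctions, linear forms (`exists_circuit`).

The main cost is extracting the bits of linear forms with values below `2 ^ M`, `M = O(log N)`
(`eval_digits`). In base `2 ^ s`, with `q` digits and `M ≤ s * q`, each layer finds one digit with
`2 ^ s` threshold gates after subtracting the higher digits. This takes depth `q + 1` and `q * 2 ^ s
+ M` gates per form. The choice `s = l / d + 1`, `q = O(d)` gives depth `O(d)` and `O(d * 2 ^ (l /
d) + l)` gates per form, where `2 ^ (l / d) ≤ N ^ (1 / d)` because `T ≥ 2`. There are `2 * N ^ ω`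
factors, and the `N ^ 2` entries are no more than `N ^ ω` because `T ^ 2 ≤ r` (`sq_le`). -/

namespace ThresholdCircuit

/-! ### Layers, composition and conjunctions of threshold circuits -/

variable {ι κ μ : Type}

/-- The gate equations determine the values of the gates. -/
theorem gateValue_eq_of_forall [Fintype ι] (C : ThresholdCircuit ι κ) (x : ι → Bool)
    (v : C.Gate → Bool)
    (hv : ∀ g, v g = true ↔
      C.threshold g ≤ (∑ i, if x i = true then C.inputWeight g i else 0) +
        ∑ h, if v h = true then C.gateWeight g h else 0) :
    C.gateValue x = v := by
  funext g
  induction g using C.wellFounded.induction with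
  | _ g ih =>
    rw [Bool.eq_iff_iff, gateValue_eq_true_iff, hv]
    have : ∀ h, (if C.gateValue x h = true then C.gateWeight g h else 0) =
        if v h = true then C.gateWeight g h else 0 := by
      intro h
      by_cases hw : C.gateWeight g h = 0
      · simp [hw]
      · rw [ih h hw]
    simp only [this]

/-- The gates can be arranged in `D` layers such that every wire goes to a later layer. -/
def HasLayers (C : ThresholdCircuit ι κ) (D : ℕ) : Prop :=
  ∃ rank : C.Gate → ℕ, (∀ g h, C.gateWeight g h ≠ 0 → rank h < rank g) ∧ ∀ g, rank g < D

/-- Layer counts add under composition, so they are tracked instead of the depth until the end. -/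
theorem HasLayers.depth_le [Fintype κ] {C : ThresholdCircuit ι κ} {D : ℕ} (hC : C.HasLayers D) :
    C.depth ≤ D := by
  classical
  obtain ⟨rank, hrank, hD⟩ := hC
  have key : ∀ g, C.gateDepth g ≤ rank g + 1 := by
    intro g
    induction g using C.wellFounded.induction with
    | _ g ih =>
      rw [gateDepth_eq, add_comm]
      refine Nat.add_le_add_right (Finset.sup_le fun h _ => ?_) 1
      split_ifs with hw
      · exact (ih h hw).trans (hrank g h hw)
      · exact Nat.zero_le _
  refine Finset.sup_le fun k _ => ?_
  rcases C.output k with i | g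
  · exact Nat.zero_le _
  · exact (key g).trans (hD g)

/-- The circuit with its output positions renamed. -/
def reindex (C : ThresholdCircuit ι κ) (e : μ → κ) : ThresholdCircuit ι μ where
  Gate := C.Gate
  gateFintype := C.gateFintype
  inputWeight := C.inputWeight
  gateWeight := C.gateWeight
  threshold := C.threshold
  wellFounded := C.wellFounded
  output := C.output ∘ e

theorem eval_reindex [Fintype ι] (C : ThresholdCircuit ι κ) (e : μ → κ) (x : ι → Bool) (k : μ) :
    (C.reindex e).eval x k = C.eval x (e k) :=
  rfl

theorem size_reindex (C : ThresholdCircuit ι κ) (e : μ → κ) : (C.reindex e).size = C.size :=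
  rfl

theorem HasLayers.reindex {C : ThresholdCircuit ι κ} {D : ℕ} (hC : C.HasLayers D) (e : μ → κ) :
    (C.reindex e).HasLayers D :=
  hC

open Classical in
/-- The circuit that feeds the outputs of `C` into `C'`. -/
noncomputable def comp [Fintype κ] (C' : ThresholdCircuit κ μ) (C : ThresholdCircuit ι κ) :
    ThresholdCircuit ι μ where
  Gate := C.Gate ⊕ C'.Gate
  gateFintype := inferInstance
  inputWeight g i := Sum.elim (fun g => C.inputWeight g i)
    -- Several output positions of `C` may read the same node, so their weights are added.
    (fun g => ∑ k, if C.output k = Sum.inl i then C'.inputWeight g k else 0) g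
  gateWeight g h := Sum.elim
    (fun g => Sum.elim (fun h => C.gateWeight g h) (fun _ => 0) h)
    (fun g => Sum.elim
      (fun h => ∑ k, if C.output k = Sum.inr h then C'.inputWeight g k else 0)
      (fun h => C'.gateWeight g h) h) g
  threshold := Sum.elim C.threshold C'.threshold
  wellFounded := by
    refine Subrelation.wf ?_ (Sum.lex_wf C.wellFounded C'.wellFounded)
    rintro (h | h) (g | g) hw
    · exact Sum.Lex.inl hw
    · exact Sum.Lex.sep _ _
    · exact absurd rfl hw
    · exact Sum.Lex.inr hw
  output k := Sum.elim (fun k => Sum.map id Sum.inl (C.output k)) (fun g => Sum.inr (Sum.inr g))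
    (C'.output k)

theorem size_comp [Fintype κ] (C' : ThresholdCircuit κ μ) (C : ThresholdCircuit ι κ) :
    (C'.comp C).size = C.size + C'.size :=
  Fintype.card_sum

theorem HasLayers.comp [Fintype κ] {C' : ThresholdCircuit κ μ} {C : ThresholdCircuit ι κ}
    {D' D : ℕ} (hC' : C'.HasLayers D') (hC : C.HasLayers D) : (C'.comp C).HasLayers (D + D') := by
  obtain ⟨rank', hrank', hD'⟩ := hC'
  obtain ⟨rank, hrank, hD⟩ := hC
  refine ⟨Sum.elim rank (fun g => D + rank' g), ?_, ?_⟩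
  · rintro (g | g) (h | h) hw
    · exact hrank g h hw
    · exact absurd rfl hw
    · exact (hD h).trans_le (Nat.le_add_right _ _)
    · exact Nat.add_lt_add_left (hrank' g h hw) D
  · rintro (g | g)
    · exact (hD g).trans_le (Nat.le_add_right _ _)
    · exact Nat.add_lt_add_left (hD' g) D

/-- The gate equations have a unique solution, so it suffices that the two assignments side by side
satisfy them. -/
theorem gateValue_comp [Fintype ι] [Fintype κ] (C' : ThresholdCircuit κ μ)
    (C : ThresholdCircuit ι κ) (x : ι → Bool) :
    (C'.comp C).gateValue x = Sum.elim (C.gateValue x) (C'.gateValue (C.eval x)) := by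
  classical
  refine gateValue_eq_of_forall (C'.comp C) x (Sum.elim (C.gateValue x) (C'.gateValue (C.eval x))) ?_
  rintro (g | g)
  · refine (gateValue_eq_true_iff C x g).trans ?_
    have : (∑ h : C.Gate ⊕ C'.Gate, if Sum.elim (C.gateValue x) (C'.gateValue (C.eval x)) h = true
        then (C'.comp C).gateWeight (Sum.inl g) h else 0) =
        ∑ h, if C.gateValue x h = true then C.gateWeight g h else 0 := by
      rw [Fintype.sum_sum_type]
      exact (congrArg (_ + ·) (Finset.sum_eq_zero fun h _ => ite_self _)).trans (add_zero _)
    exact iff_of_eq (congrArg (fun t => _ ≤ _ + t) this.symm)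
  · refine (gateValue_eq_true_iff C' (C.eval x) g).trans ?_
    have hgates : (∑ h : C.Gate ⊕ C'.Gate,
        if Sum.elim (C.gateValue x) (C'.gateValue (C.eval x)) h = true
        then (C'.comp C).gateWeight (Sum.inr g) h else 0) =
        (∑ h, if C.gateValue x h = true then
          (∑ k, if C.output k = Sum.inr h then C'.inputWeight g k else 0) else 0) +
        ∑ h, if C'.gateValue (C.eval x) h = true then C'.gateWeight g h else 0 := by
      rw [Fintype.sum_sum_type]
      rfl
    have hinputs : (∑ k, if C.eval x k = true then C'.inputWeight g k else 0) =
        (∑ i, if x i = true then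
          (∑ k, if C.output k = Sum.inl i then C'.inputWeight g k else 0) else 0) +
        ∑ h, if C.gateValue x h = true then
          (∑ k, if C.output k = Sum.inr h then C'.inputWeight g k else 0) else 0 := by
      -- Each output position reads exactly one node, so the sum over positions can be grouped by
      -- nodes.
      have hnodes : (∑ n : ι ⊕ C.Gate, if Sum.elim x (C.gateValue x) n = true then
          (∑ k, if C.output k = n then C'.inputWeight g k else 0) else 0) =
          ∑ k, if C.eval x k = true then C'.inputWeight g k else 0 := by
        calc _ = ∑ n, ∑ k, if C.output k = n then
              (if Sum.elim x (C.gateValue x) n = true then C'.inputWeight g k else 0) else 0 := by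
              refine Finset.sum_congr rfl fun n _ => ?_
              split_ifs <;> simp
          _ = _ := by
              rw [Finset.sum_comm]
              refine Finset.sum_congr rfl fun k _ => ?_
              rw [Finset.sum_ite_eq, if_pos (Finset.mem_univ _)]
              rfl
      rw [← hnodes, Fintype.sum_sum_type]
      rfl
    refine iff_of_eq (congrArg (fun t => C'.threshold g ≤ t) ?_)
    rw [hinputs, add_assoc]
    exact congrArg (_ + ·) hgates.symm

theorem eval_comp [Fintype ι] [Fintype κ] (C' : ThresholdCircuit κ μ)
    (C : ThresholdCircuit ι κ) (x : ι → Bool) :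
    (C'.comp C).eval x = C'.eval (C.eval x) := by
  funext k
  unfold eval
  rw [gateValue_comp]
  change Sum.elim x _ (Sum.elim _ _ (C'.output k)) = Sum.elim (C.eval x) _ (C'.output k)
  rcases C'.output k with i | g
  · change Sum.elim x _ (Sum.map id Sum.inl (C.output i)) = Sum.elim x _ (C.output i)
    rcases C.output i with j | h <;> rfl
  · rfl

open Classical in
/-- The circuit that computes the conjunctions of the pairs `(fst p, snd p)` of its inputs. -/
noncomputable def andPairs (fst snd : κ → ι) [Fintype κ] : ThresholdCircuit ι κ where
  Gate := κ
  gateFintype := inferInstance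
  inputWeight p i := (if fst p = i then 1 else 0) + (if snd p = i then 1 else 0)
  gateWeight _ _ := 0
  threshold _ := 2
  wellFounded := ⟨fun a => ⟨a, fun _ h => absurd rfl h⟩⟩
  output := Sum.inr

theorem size_andPairs (fst snd : κ → ι) [Fintype κ] : (andPairs fst snd).size = Fintype.card κ :=
  rfl

theorem hasLayers_andPairs (fst snd : κ → ι) [Fintype κ] : (andPairs fst snd).HasLayers 1 :=
  ⟨fun _ => 0, fun _ _ h => absurd rfl h, fun _ => Nat.one_pos⟩

theorem eval_andPairs (fst snd : κ → ι) [Fintype ι] [Fintype κ] (x : ι → Bool) (p : κ) :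
    (andPairs fst snd).eval x p = (x (fst p) && x (snd p)) := by
  classical
  change (andPairs fst snd).gateValue x p = _
  refine Bool.eq_iff_iff.2 ((gateValue_eq_true_iff (andPairs fst snd) x p).trans ?_)
  change (2 : ℤ) ≤ (∑ i, if x i = true then
    ((if fst p = i then 1 else 0) + (if snd p = i then 1 else 0)) else 0) +
    (∑ h : κ, if (andPairs fst snd).gateValue x h = true then 0 else 0) ↔ _
  have : ∀ i, (if x i = true then
      (((if fst p = i then 1 else 0) + (if snd p = i then 1 else 0)) : ℤ) else 0) =
      (if fst p = i then (if x i = true then 1 else 0) else 0) +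
      (if snd p = i then (if x i = true then 1 else 0) else 0) := by
    intro i
    split_ifs <;> rfl
  simp only [this, Finset.sum_add_distrib, Finset.sum_ite_eq, Finset.mem_univ, if_true, ite_self,
    Finset.sum_const_zero]
  cases x (fst p) <;> cases x (snd p) <;> simp

end ThresholdCircuit

/-! ### Binary digits of linear forms -/

/-- The higher base-`2 ^ s` digits of a number below `2 ^ (s * q)` and its remainder. -/
theorem sum_digits_above_add_mod (Z s q : ℕ) (hZ : Z < 2 ^ (s * q)) (n : ℕ) (hn : n ≤ q) :
    (∑ j ∈ Finset.range q, if n ≤ j then 2 ^ (s * j) * (Z / 2 ^ (s * j) % 2 ^ s) else 0) +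
      Z % 2 ^ (s * n) = Z := by
  -- Descending from `n = q`, where the remainder is `Z`, each step moves digit `n` from the
  -- remainder into the sum.
  induction hn using Nat.decreasingInduction with
  | self =>
    rw [Finset.sum_eq_zero, Nat.mod_eq_of_lt hZ, zero_add]
    intro j hj
    exact if_neg (not_le.2 (Finset.mem_range.1 hj))
  | of_succ n hn ih =>
    rw [mul_add, mul_one, pow_add, Nat.mod_mul] at ih
    have hsplit : ∀ j ∈ Finset.range q,
        (if n ≤ j then 2 ^ (s * j) * (Z / 2 ^ (s * j) % 2 ^ s) else 0) =
        (if n + 1 ≤ j then 2 ^ (s * j) * (Z / 2 ^ (s * j) % 2 ^ s) else 0) +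
        if n = j then 2 ^ (s * j) * (Z / 2 ^ (s * j) % 2 ^ s) else 0 := by
      intro j _
      rcases lt_trichotomy n j with h | h | h
      · rw [if_pos h.le, if_pos (show n + 1 ≤ j from h), if_neg h.ne, add_zero]
      · rw [if_pos h.le, if_neg (by omega), if_pos h, zero_add]
      · rw [if_neg (by omega), if_neg (by omega), if_neg (by omega)]
    rw [Finset.sum_congr rfl hsplit, Finset.sum_add_distrib, Finset.sum_ite_eq,
      if_pos (Finset.mem_range.2 hn)]
    omega

theorem natOfBits_testBit (M Z : ℕ) (hZ : Z < 2 ^ M) :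
    natOfBits (fun k : Fin M => Z.testBit k) = Z := by
  have key : ∀ M, ∑ k ∈ Finset.range M, (Z.testBit k).toNat * 2 ^ k = Z % 2 ^ M := by
    intro M
    induction M with
    | zero => simp [Nat.mod_one]
    | succ M ih =>
      rw [Finset.sum_range_succ, ih, Nat.mod_pow_succ, Nat.toNat_testBit, mul_comm]
  rw [natOfBits, Fin.sum_univ_eq_sum_range (fun k => (Z.testBit k).toNat * 2 ^ k), key,
    Nat.mod_eq_of_lt hZ]

/-- A sum over an initial segment, with the segment expressed by an indicator. -/
theorem sum_fin_ite_succ_le (m n : ℕ) (h : n ≤ m) (f : ℕ → ℤ) :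
    (∑ v : Fin m, if (v : ℕ) + 1 ≤ n then f v else 0) = ∑ v ∈ Finset.range n, f v := by
  rw [Fin.sum_univ_eq_sum_range (fun v => if v + 1 ≤ n then f v else 0), ← Finset.sum_filter]
  congr 1
  ext v
  simp only [Finset.mem_filter, Finset.mem_range]
  omega

namespace ThresholdCircuit

variable {ι φ : Type}

/-- The circuit that extracts the `M` binary digits of the values of the linear forms `w f` in the
inputs. The values of the forms are decomposed into `q` digits in base `2 ^ s`, the most significant
digit first: the gate `(f, j, v)` tells whether digit number `j` exceeds `v`. -/
noncomputable def digits [Fintype φ] (w : φ → ι → ℕ) (q s M : ℕ) :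
    ThresholdCircuit ι (φ × Fin M) where
  Gate := φ × Fin q × Fin (2 ^ s) ⊕ φ × Fin M
  gateFintype := inferInstance
  inputWeight g i := Sum.elim (fun g => (w g.1 i : ℤ)) (fun _ => 0) g
  gateWeight g h := by
    classical
    exact Sum.elim
      (fun g => Sum.elim
        -- The number of firing gates for a digit equals that digit, so equal weights `-2 ^ (s *
        -- j')` subtract its whole contribution.
        (fun h => if g.1 = h.1 then if g.2.1 < h.2.1 then -2 ^ (s * h.2.1) else 0 else 0)
        (fun _ => 0) h)
      (fun g => Sum.elim
        -- If the digit is `D`, exactly the gates `v < D` fire, and the differences telescope to the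
        -- required bit of `D`.
        (fun h => if g.1 = h.1 then if h.2.1 = g.2 / s then
          ((((h.2.2 + 1 : ℕ).testBit (g.2 % s)).toNat : ℤ) -
            ((h.2.2 : ℕ).testBit (g.2 % s)).toNat) else 0 else 0)
        (fun _ => 0) h) g
  -- What remains after the subtraction is `Z % 2 ^ (s * (j + 1))`. It reaches `(v + 1) * 2 ^ (s *
  -- j)` iff digit `j` exceeds `v`.
  threshold := Sum.elim (fun g => (g.2.2 + 1) * 2 ^ (s * g.2.1)) (fun _ => 1)
  wellFounded := by
    refine Subrelation.wf ?_
      (measure (Sum.elim (fun g : φ × Fin q × Fin (2 ^ s) => q - 1 - g.2.1)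
        (fun _ : φ × Fin M => q))).wf
    rintro (h | h) (g | g) hw
    · change q - 1 - (h.2.1 : ℕ) < q - 1 - g.2.1
      dsimp at hw
      split_ifs at hw with h1 h2
      · have := h.2.1.isLt
        have : (g.2.1 : ℕ) < h.2.1 := h2
        omega
      · exact absurd rfl hw
      · exact absurd rfl hw
    · change q - 1 - (h.2.1 : ℕ) < q
      have := h.2.1.isLt
      omega
    · exact absurd rfl hw
    · exact absurd rfl hw
  output k := Sum.inr (Sum.inr k)

theorem size_digits [Fintype φ] (w : φ → ι → ℕ) (q s M : ℕ) :
    (digits w q s M).size = Fintype.card φ * (q * 2 ^ s + M) := by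
  rw [mul_add]
  change Fintype.card (φ × Fin q × Fin (2 ^ s) ⊕ φ × Fin M) = _
  simp

theorem hasLayers_digits [Fintype φ] (w : φ → ι → ℕ) (q s M : ℕ) :
    (digits w q s M).HasLayers (q + 1) := by
  -- Digit `j` sits in layer `q - 1 - j`, and all bit gates form the last layer `q`.
  refine ⟨Sum.elim (fun g : φ × Fin q × Fin (2 ^ s) => q - 1 - g.2.1)
        (fun _ : φ × Fin M => q), ?_, ?_⟩
  · rintro (g | g) (h | h) hw
    · change q - 1 - (h.2.1 : ℕ) < q - 1 - g.2.1
      dsimp [digits] at hw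
      split_ifs at hw with h1 h2
      · have := h.2.1.isLt
        have : (g.2.1 : ℕ) < h.2.1 := h2
        omega
      · exact absurd rfl hw
      · exact absurd rfl hw
    · exact absurd rfl hw
    · change q - 1 - (h.2.1 : ℕ) < q
      have := h.2.1.isLt
      omega
    · exact absurd rfl hw
  · rintro (g | g)
    · change q - 1 - (g.2.1 : ℕ) < q + 1
      omega
    · exact Nat.lt_succ_self q

theorem eval_digits [Fintype ι] [Fintype φ] (w : φ → ι → ℕ) (q s M : ℕ) (hM : M ≤ s * q)
    (hw : ∀ f, ∑ i, w f i < 2 ^ (s * q)) (x : ι → Bool) (f : φ) (k : Fin M) :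
    (digits w q s M).eval x (f, k) = (∑ i, if x i = true then w f i else 0).testBit k := by
  classical
  set Z : φ → ℕ := fun f => ∑ i, if x i = true then w f i else 0 with hZ
  have hZlt : ∀ f, Z f < 2 ^ (s * q) := fun f =>
    (Finset.sum_le_sum fun i _ => by split_ifs <;> simp).trans_lt (hw f)
  have hmain : (digits w q s M).gateValue x =
      Sum.elim (fun g => decide (g.2.2 + 1 ≤ Z g.1 / 2 ^ (s * g.2.1) % 2 ^ s))
        (fun g => (Z g.1).testBit g.2) := by
    refine gateValue_eq_of_forall (digits w q s M) x (Sum.elim (fun g : φ × Fin q × Fin (2 ^ s) =>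
      decide (g.2.2 + 1 ≤ Z g.1 / 2 ^ (s * g.2.1) % 2 ^ s))
        (fun g : φ × Fin M => (Z g.1).testBit g.2)) ?_
    have hgates : ∀ (f : φ) (F : Fin q → Fin (2 ^ s) → ℤ),
        (∑ h : φ × Fin q × Fin (2 ^ s), if decide ((h.2.2 : ℕ) + 1 ≤
          Z h.1 / 2 ^ (s * h.2.1) % 2 ^ s) = true then
          (if f = h.1 then F h.2.1 h.2.2 else 0) else 0) =
        ∑ j : Fin q, ∑ v : Fin (2 ^ s), if (v : ℕ) + 1 ≤ Z f / 2 ^ (s * j) % 2 ^ s then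
          F j v else 0 := by
      intro f F
      rw [Fintype.sum_prod_type, Finset.sum_eq_single f]
      · simp [Fintype.sum_prod_type]
      · intro b _ hb
        simp [hb.symm]
      · simp
    rintro (⟨f, j, v⟩ | ⟨f, k⟩)
    · have hin : (∑ i, if x i = true then (digits w q s M).inputWeight (Sum.inl (f, j, v)) i
          else 0) = (Z f : ℤ) := by
        simp [digits, hZ]
      have hg : (∑ h : φ × Fin q × Fin (2 ^ s) ⊕ φ × Fin M,
          if (Sum.elim (fun g : φ × Fin q × Fin (2 ^ s) =>
            decide (g.2.2 + 1 ≤ Z g.1 / 2 ^ (s * g.2.1) % 2 ^ s))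
            (fun g : φ × Fin M => (Z g.1).testBit g.2)) h = true then
          (digits w q s M).gateWeight (Sum.inl (f, j, v)) h else 0) =
          -((Z f : ℤ) - (Z f % 2 ^ (s * (j + 1)) : ℕ)) := by
        rw [Fintype.sum_sum_type]
        refine (congrArg₂ (· + ·) (hgates f fun j' _ => if j < j' then -2 ^ (s * (j' : ℕ)) else 0)
          (Finset.sum_eq_zero fun h _ => ite_self _)).trans ?_
        have := sum_digits_above_add_mod (Z f) s q (hZlt f) (j + 1) j.isLt
        rw [← Fin.sum_univ_eq_sum_range (fun j' => if (j : ℕ) + 1 ≤ j' then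
          2 ^ (s * j') * (Z f / 2 ^ (s * j') % 2 ^ s) else 0)] at this
        have hsum := congrArg (Nat.cast : ℕ → ℤ) this
        rw [Nat.cast_add] at hsum
        rw [add_zero, ← eq_sub_of_add_eq hsum, Nat.cast_sum, ← Finset.sum_neg_distrib]
        refine Finset.sum_congr rfl fun j' _ => ?_
        rw [sum_fin_ite_succ_le _ _ (Nat.mod_lt _ (by positivity)).le
          (fun _ => if j < j' then -2 ^ (s * (j' : ℕ)) else 0), Finset.sum_const,
          Finset.card_range]
        by_cases h : j < j'
        · rw [if_pos h, if_pos (by exact_mod_cast h), nsmul_eq_mul]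
          push_cast
          ring
        · rw [if_neg h, if_neg (by exact_mod_cast h), smul_zero, Nat.cast_zero, neg_zero]
      rw [hin]
      refine Iff.trans ?_ (iff_of_eq (congrArg (fun t => _ ≤ _ + t) hg.symm))
      change decide _ = true ↔ ((v : ℤ) + 1) * 2 ^ (s * (j : ℕ)) ≤ _
      rw [decide_eq_true_eq, neg_sub, add_sub_cancel, mul_add, mul_one, pow_add,
        ← Nat.mod_mul_right_div_self, Nat.le_div_iff_mul_le (by positivity)]
      exact_mod_cast Iff.rfl
    · have hs : 0 < s := by
        rcases Nat.eq_zero_or_pos s with rfl | h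
        · have := k.isLt
          omega
        · exact h
      have hkq : (k : ℕ) / s < q := Nat.div_lt_of_lt_mul (k.isLt.trans_le hM)
      have hin : (∑ i, if x i = true then (digits w q s M).inputWeight (Sum.inr (f, k)) i
          else 0) = 0 := Finset.sum_eq_zero fun i _ => ite_self _
      have hg : (∑ h : φ × Fin q × Fin (2 ^ s) ⊕ φ × Fin M,
          if (Sum.elim (fun g : φ × Fin q × Fin (2 ^ s) =>
            decide (g.2.2 + 1 ≤ Z g.1 / 2 ^ (s * g.2.1) % 2 ^ s))
            (fun g : φ × Fin M => (Z g.1).testBit g.2)) h = true then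
          (digits w q s M).gateWeight (Sum.inr (f, k)) h else 0) =
          (((Z f).testBit k).toNat : ℤ) := by
        rw [Fintype.sum_sum_type]
        refine (congrArg₂ (· + ·) (hgates f fun j v => if (j : ℕ) = k / s then
          ((((v + 1 : ℕ).testBit (k % s)).toNat : ℤ) -
            ((v : ℕ).testBit (k % s)).toNat) else 0)
          (Finset.sum_eq_zero fun h _ => ite_self _)).trans ?_
        rw [add_zero, Finset.sum_eq_single (⟨k / s, hkq⟩ : Fin q)]
        · simp only [if_true]
          rw [sum_fin_ite_succ_le _ _ (Nat.mod_lt _ (by positivity)).le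
            (fun v => (((v + 1).testBit (k % s)).toNat : ℤ) - (v.testBit (k % s)).toNat),
            Finset.sum_range_sub (fun v => ((v.testBit (k % s)).toNat : ℤ)),
            Nat.testBit_mod_two_pow, Nat.testBit_div_two_pow]
          simp [Nat.mod_lt _ hs, Nat.mod_add_div]
        · intro j _ hj
          refine Finset.sum_eq_zero fun v _ => ?_
          rw [if_neg fun h => hj (Fin.ext h), ite_self]
        · simp
      rw [hin]
      refine Iff.trans ?_ (iff_of_eq (congrArg (fun t => _ ≤ _ + t) hg.symm))
      change (Z f).testBit k = true ↔ (1 : ℤ) ≤ 0 + _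
      cases (Z f).testBit k <;> simp
  change (digits w q s M).gateValue x (Sum.inr (f, k)) = _
  rw [hmain]
  rfl

/-- Linear forms with integer coefficients are evaluated by evaluating their positive and negative
parts. -/
theorem exists_linearForms [Fintype ι] [Fintype φ] (W : φ → ι → ℤ) (q s M : ℕ) (hM : M ≤ s * q)
    (hW : ∀ f, ∑ i, |W f i| < 2 ^ M) :
    ∃ C : ThresholdCircuit ι (φ × Bool × Fin M),
      C.size = 2 * Fintype.card φ * (q * 2 ^ s + M) ∧ C.HasLayers (q + 1) ∧
      ∀ x f, (natOfBits fun k => C.eval x (f, true, k) : ℤ) -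
        natOfBits (fun k => C.eval x (f, false, k)) = ∑ i, W f i * (x i).toNat := by
  let w : φ × Bool → ι → ℕ := fun f i => if f.2 = true then (W f.1 i).toNat else (-W f.1 i).toNat
  have hw : ∀ f, ∑ i, w f i < 2 ^ M := by
    intro f
    have h : (∑ i, (w f i : ℤ)) ≤ ∑ i, |W f.1 i| := by
      refine Finset.sum_le_sum fun i _ => ?_
      simp only [w]
      split_ifs
      · rw [Int.toNat_eq_max]
        exact max_le (le_abs_self _) (abs_nonneg _)
      · rw [Int.toNat_eq_max]
        exact max_le (neg_le_abs _) (abs_nonneg _)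
    exact_mod_cast h.trans_lt (hW f.1)
  have hw' : ∀ f, ∑ i, w f i < 2 ^ (s * q) := fun f =>
    (hw f).trans_le (Nat.pow_le_pow_right two_pos hM)
  refine ⟨(digits w q s M).reindex fun k => ((k.1, k.2.1), k.2.2), ?_,
    (hasLayers_digits w q s M).reindex _, ?_⟩
  · rw [size_reindex, size_digits]
    simp [mul_comm]
  · intro x f
    have hle : ∀ f, (∑ i, if x i = true then w f i else 0) < 2 ^ M := fun f =>
      lt_of_le_of_lt (Finset.sum_le_sum fun i _ => by split_ifs <;> simp) (hw f)
    simp only [eval_reindex, eval_digits w q s M hM hw']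
    rw [natOfBits_testBit, natOfBits_testBit]
    · push_cast
      rw [← Finset.sum_sub_distrib]
      refine Finset.sum_congr rfl fun i _ => ?_
      cases x i
      · simp
      · simp only [w, if_true, Bool.toNat_true, Nat.cast_one, mul_one, Bool.false_eq_true, if_false]
        omega
    · exact hle (f, false)
    · exact hle (f, true)

end ThresholdCircuit

/-! ### Tensor powers of the bilinear scheme -/

namespace FastMatMulAlgorithm

variable {T r : ℕ}

/-- The coefficients of the bilinear identity behind a matrix multiplication algorithm. -/
theorem sum_weight_mul (alg : FastMatMulAlgorithm T r) (p q j k j' k' : Fin T) :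
    ∑ i, alg.weightC p q i * (alg.weightA i j k * alg.weightB i j' k') =
      if p = j ∧ k = j' ∧ k' = q then 1 else 0 := by
  -- Matrix units isolate one coefficient of the bilinear identity.
  have h := alg.correct (Matrix.single j k 1) (Matrix.single j' k' 1) p q
  have hA : ∀ (w : Fin T → Fin T → ℤ) (a b : Fin T),
      ∑ a', ∑ b', w a' b' * Matrix.single a b (1 : ℤ) a' b' = w a b := by
    intro w a b
    rw [Finset.sum_eq_single a, Finset.sum_eq_single b]
    · simp
    · intro b' _ hb
      simp [Matrix.single, hb.symm]
    · simp
    · intro a' _ ha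
      simp [Matrix.single, ha.symm]
    · simp
  simp only [hA] at h
  rw [← h]
  by_cases hk : k = j'
  · subst hk
    rw [Matrix.single_mul_single_same]
    simp [Matrix.single, eq_comm]
  · rw [Matrix.single_mul_single_of_ne _ _ _ _ hk]
    simp [hk]

/-- Multiplying `T × T` matrices takes at least `T ^ 2` multiplications. -/
theorem sq_le (hT : 0 < T) (alg : FastMatMulAlgorithm T r) : T ^ 2 ≤ r := by
  -- With the inner indices fixed at `0`, the coefficient identity factors the identity matrix of
  -- size `T ^ 2` through dimension `r`; compare ranks.
  let X : Matrix (Fin T × Fin T) (Fin r) ℤ := Matrix.of fun p i => alg.weightC p.1 p.2 i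
  let Y : Matrix (Fin r) (Fin T × Fin T) ℤ :=
    Matrix.of fun i p => alg.weightA i p.1 ⟨0, hT⟩ * alg.weightB i ⟨0, hT⟩ p.2
  have hXY : X * Y = 1 := by
    ext p p'
    rw [Matrix.mul_apply]
    refine (alg.sum_weight_mul p.1 p.2 p'.1 _ _ p'.2).trans ?_
    rw [Matrix.one_apply]
    exact if_congr (by rw [Prod.ext_iff]; simp [eq_comm]) rfl rfl
  have h := Matrix.rank_mul_le_left X Y
  rw [hXY, Matrix.rank_one] at h
  have := h.trans (Matrix.rank_le_card_width X)
  simpa [sq] using this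

/-- The tensor power of the weights. -/
def powWeight {α : Type} {n l : ℕ} (w : α → Fin n → Fin n → ℤ) (i : Fin l → α)
    (p q : Fin (n ^ l)) : ℤ :=
  -- The base-`T` digits of `p` and `q` are the block positions at the `l` levels.
  ∏ t, w (i t) (finFunctionFinEquiv.symm p t) (finFunctionFinEquiv.symm q t)

theorem abs_powWeight_le {α : Type} {n l : ℕ} {w : α → Fin n → Fin n → ℤ}
    (hw : ∀ i p q, w i p q ∈ ({-1, 0, 1} : Set ℤ)) (i : Fin l → α) (p q : Fin (n ^ l)) :
    |powWeight w i p q| ≤ 1 := by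
  rw [powWeight, Finset.abs_prod]
  refine Finset.prod_le_one (fun _ _ => abs_nonneg _) fun t _ => ?_
  rcases hw (i t) (finFunctionFinEquiv.symm p t) (finFunctionFinEquiv.symm q t) with h | h | h <;>
    rw [h] <;> simp

/-- The recursive algorithm, unrolled: `T ^ l × T ^ l` matrices are multiplied with `r ^ l`
multiplications. -/
theorem mul_apply_eq_sum_powWeight (alg : FastMatMulAlgorithm T r) (l : ℕ)
    (A B : Matrix (Fin (T ^ l)) (Fin (T ^ l)) ℤ) (p q : Fin (T ^ l)) :
    (A * B) p q = ∑ i : Fin l → Fin r, powWeight (fun i p q => alg.weightC p q i) i p q *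
      ((∑ j, ∑ k, powWeight alg.weightA i j k * A j k) *
        (∑ j, ∑ k, powWeight alg.weightB i j k * B j k)) := by
  have hcoeff : ∀ j k j' k' : Fin (T ^ l),
      ∑ i : Fin l → Fin r, powWeight (fun i p q => alg.weightC p q i) i p q *
        (powWeight alg.weightA i j k * powWeight alg.weightB i j' k') =
      if p = j ∧ k = j' ∧ k' = q then 1 else 0 := by
    intro j k j' k'
    simp only [powWeight, ← Finset.prod_mul_distrib]
    -- By distributivity, the sum over `l`-tuples of multiplications is a product over levels of the
    -- one-level coefficients.
    rw [← Fintype.piFinset_univ, ← Finset.prod_univ_sum (fun _ => Finset.univ) (fun t i =>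
      alg.weightC (finFunctionFinEquiv.symm p t) (finFunctionFinEquiv.symm q t) i *
      (alg.weightA i (finFunctionFinEquiv.symm j t) (finFunctionFinEquiv.symm k t) *
        alg.weightB i (finFunctionFinEquiv.symm j' t) (finFunctionFinEquiv.symm k' t)))]
    simp only [sum_weight_mul]
    split_ifs with h
    · obtain ⟨rfl, rfl, rfl⟩ := h
      simp
    · by_contra hne
      refine h ?_
      have hall := fun t => Finset.prod_ne_zero_iff.1 hne t (Finset.mem_univ t)
      simp only [ne_eq, ite_eq_right_iff, one_ne_zero, imp_false, not_not] at hall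
      exact ⟨finFunctionFinEquiv.symm.injective (funext fun t => (hall t).1),
        finFunctionFinEquiv.symm.injective (funext fun t => (hall t).2.1),
        finFunctionFinEquiv.symm.injective (funext fun t => (hall t).2.2)⟩
  have hexpand : ∀ i : Fin l → Fin r, powWeight (fun i p q => alg.weightC p q i) i p q *
      ((∑ j, ∑ k, powWeight alg.weightA i j k * A j k) *
        (∑ j, ∑ k, powWeight alg.weightB i j k * B j k)) =
      ∑ j', ∑ k', ∑ j, ∑ k, (powWeight (fun i p q => alg.weightC p q i) i p q *
        (powWeight alg.weightA i j k * powWeight alg.weightB i j' k')) * (A j k * B j' k') := by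
    intro i
    simp only [Finset.sum_mul, Finset.mul_sum]
    refine Finset.sum_congr rfl fun j' _ => Finset.sum_congr rfl fun k' _ =>
      Finset.sum_congr rfl fun j _ => Finset.sum_congr rfl fun k _ => ?_
    ring
  simp only [hexpand]
  rw [Finset.sum_comm]
  simp only [Finset.sum_comm (s := (Finset.univ : Finset (Fin l → Fin r))), ← Finset.sum_mul,
    hcoeff]
  rw [Matrix.mul_apply]
  simp [ite_and, Finset.sum_ite_eq]

end FastMatMulAlgorithm

/-! ### Assembling the multiplication circuit -/

/-- The weight of a digit in a signed number: `2 ^ k`, with the sign of the part it belongs to. -/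
def digitWeight {M : ℕ} (a : Bool × Fin M) : ℤ :=
  cond a.1 1 (-1) * 2 ^ (a.2 : ℕ)

theorem sum_digitWeight_mul {M : ℕ} (x : Bool × Fin M → Bool) :
    ∑ a, digitWeight a * (x a).toNat =
      (natOfBits fun k => x (true, k) : ℤ) - natOfBits fun k => x (false, k) := by
  rw [Fintype.sum_prod_type, Fintype.sum_bool]
  simp only [digitWeight, natOfBits, cond_true, cond_false, Nat.cast_sum, Nat.cast_mul,
    Nat.cast_pow, Nat.cast_ofNat, sub_eq_add_neg, ← Finset.sum_neg_distrib]
  congr 1 <;> exact Finset.sum_congr rfl fun k _ => by ring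

theorem abs_digitWeight_le {M : ℕ} (a : Bool × Fin M) : |digitWeight a| ≤ 2 ^ M := by
  obtain ⟨s, k⟩ := a
  have h : |(2 : ℤ) ^ (k : ℕ)| ≤ 2 ^ M := by
    rw [abs_of_nonneg (by positivity)]
    exact pow_le_pow_right₀ one_le_two k.isLt.le
  cases s <;> simpa [digitWeight] using h

theorem matrixOfBits_apply {N b : ℕ} (x : MatrixBits N b → Bool) (i j : Fin N) :
    matrixOfBits x i j = ∑ a, digitWeight a * (x (i, j, a)).toNat :=
  (sum_digitWeight_mul fun a => x (i, j, a)).symm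

theorem sum_abs_lt_two_pow {ι : Type} [Fintype ι] (w : ι → ℤ) (B M : ℕ) (hw : ∀ i, |w i| ≤ 2 ^ B)
    (h : Fintype.card ι * 2 ^ B < 2 ^ M) : ∑ i, |w i| < 2 ^ M := by
  refine lt_of_le_of_lt (Finset.sum_le_card_nsmul _ _ (2 ^ B) fun i _ => hw i) ?_
  rw [nsmul_eq_mul, Finset.card_univ]
  exact_mod_cast h

namespace FastMatMulAlgorithm

variable {T r : ℕ}

/-- The circuit that computes the factors of the multiplications, multiplies their digits pairwise
and adds the results up. -/
theorem exists_circuit (alg : FastMatMulAlgorithm T r) (l b q s M q' s' M' : ℕ)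
    (hM : M ≤ s * q) (hM' : M' ≤ s' * q')
    (hfactor : Fintype.card (MatrixBits (T ^ l) b ⊕ MatrixBits (T ^ l) b) * 2 ^ b < 2 ^ M)
    (hproduct : r ^ l * (2 * M * (2 * M)) * 2 ^ (M + M) < 2 ^ M') :
    ∃ C : ThresholdCircuit (MatrixBits (T ^ l) b ⊕ MatrixBits (T ^ l) b) (MatrixBits (T ^ l) M'),
      C.ComputesMatrixProduct ∧ C.HasLayers (q + 1 + 1 + (q' + 1)) ∧
      C.size = 2 * (r ^ l + r ^ l) * (q * 2 ^ s + M) + r ^ l * (2 * M * (2 * M)) +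
        2 * (T ^ l * T ^ l) * (q' * 2 ^ s' + M') := by
  let W : (Fin l → Fin r) ⊕ (Fin l → Fin r) → MatrixBits (T ^ l) b ⊕ MatrixBits (T ^ l) b → ℤ :=
    fun f n => Sum.elim
      (fun i => Sum.elim (fun a => powWeight alg.weightA i a.1 a.2.1 * digitWeight a.2.2)
        (fun _ => 0) n)
      (fun i => Sum.elim (fun _ => 0)
        (fun a => powWeight alg.weightB i a.1 a.2.1 * digitWeight a.2.2) n) f
  have hmul : ∀ (B : ℕ) (u v : ℤ), |u| ≤ 1 → |v| ≤ 2 ^ B → |u * v| ≤ 2 ^ B := by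
    intro B u v hu hv
    rw [abs_mul]
    exact (mul_le_of_le_one_left (abs_nonneg v) hu).trans hv
  have hW : ∀ f, ∑ i, |W f i| < 2 ^ M := by
    refine fun f => sum_abs_lt_two_pow _ b M (fun n => ?_) hfactor
    rcases f with i | i <;> rcases n with a | a
    · exact hmul _ _ _ (abs_powWeight_le alg.weightA_mem _ _ _) (abs_digitWeight_le _)
    · simp [W]
    · simp [W]
    · exact hmul _ _ _ (abs_powWeight_le alg.weightB_mem _ _ _) (abs_digitWeight_le _)
  obtain ⟨C, hCsize, hClayers, hC⟩ := ThresholdCircuit.exists_linearForms W q s M hM hW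
  -- One conjunction for each multiplication and each pair of signed digits of its two factors.
  let P := (Fin l → Fin r) × (Bool × Fin M) × (Bool × Fin M)
  let W' : Fin (T ^ l) × Fin (T ^ l) → P → ℤ := fun e p =>
    powWeight (fun i p q => alg.weightC p q i) p.1 e.1 e.2 *
      (digitWeight p.2.1 * digitWeight p.2.2)
  have hP : Fintype.card P = r ^ l * (2 * M * (2 * M)) := by
    simp [P]
  have hW' : ∀ e, ∑ p, |W' e p| < 2 ^ M' := by
    refine fun e => sum_abs_lt_two_pow _ (M + M) M' (fun p => ?_) (hP ▸ hproduct)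
    refine hmul _ _ _ (abs_powWeight_le (fun i p q => alg.weightC_mem p q i) _ _ _) ?_
    rw [abs_mul, pow_add]
    exact mul_le_mul (abs_digitWeight_le _) (abs_digitWeight_le _) (abs_nonneg _) (by positivity)
  obtain ⟨C', hCsize', hClayers', hC'⟩ := ThresholdCircuit.exists_linearForms W' q' s' M' hM' hW'
  let D := ThresholdCircuit.andPairs (κ := P) (ι := ((Fin l → Fin r) ⊕ (Fin l → Fin r)) ×
    Bool × Fin M) (fun p => (Sum.inl p.1, p.2.1)) (fun p => (Sum.inr p.1, p.2.2))
  refine ⟨(C'.comp (D.comp C)).reindex fun k => ((k.1, k.2.1), k.2.2), ?_,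
    (hClayers'.comp ((ThresholdCircuit.hasLayers_andPairs _ _).comp hClayers)).reindex _, ?_⟩
  · intro x y
    have hA : ∀ i, ∑ a, digitWeight a * ((C.eval (Sum.elim x y) (Sum.inl i, a)).toNat : ℤ) =
        ∑ j, ∑ k, powWeight alg.weightA i j k * matrixOfBits x j k := by
      intro i
      rw [sum_digitWeight_mul fun a => C.eval (Sum.elim x y) (Sum.inl i, a), hC,
        Fintype.sum_sum_type]
      simp only [W, Sum.elim_inl, Sum.elim_inr, zero_mul, Finset.sum_const_zero, add_zero,
        Fintype.sum_prod_type (α₁ := Fin (T ^ l)), matrixOfBits_apply, Finset.mul_sum, mul_assoc]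
    have hB : ∀ i, ∑ a, digitWeight a * ((C.eval (Sum.elim x y) (Sum.inr i, a)).toNat : ℤ) =
        ∑ j, ∑ k, powWeight alg.weightB i j k * matrixOfBits y j k := by
      intro i
      rw [sum_digitWeight_mul fun a => C.eval (Sum.elim x y) (Sum.inr i, a), hC,
        Fintype.sum_sum_type]
      simp only [W, Sum.elim_inl, Sum.elim_inr, zero_mul, Finset.sum_const_zero, zero_add,
        Fintype.sum_prod_type (α₁ := Fin (T ^ l)), matrixOfBits_apply, Finset.mul_sum, mul_assoc]
    have hand : ∀ u v : Bool, ((u && v).toNat : ℤ) = u.toNat * v.toNat := by decide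
    ext p t
    rw [mul_apply_eq_sum_powWeight]
    have houtput := hC' ((D.comp C).eval (Sum.elim x y)) (p, t)
    rw [← ThresholdCircuit.eval_comp] at houtput
    refine Eq.trans houtput ?_
    rw [Fintype.sum_prod_type]
    refine Finset.sum_congr rfl fun i _ => ?_
    rw [← hA, ← hB, Finset.sum_mul_sum, Fintype.sum_prod_type, Finset.mul_sum]
    refine Finset.sum_congr rfl fun a _ => ?_
    rw [Finset.mul_sum]
    refine Finset.sum_congr rfl fun a' _ => ?_
    rw [ThresholdCircuit.eval_comp, ThresholdCircuit.eval_andPairs]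
    simp only [W', hand]
    ring
  · rw [ThresholdCircuit.size_reindex, ThresholdCircuit.size_comp, ThresholdCircuit.size_comp,
      hCsize, hCsize', ThresholdCircuit.size_andPairs, hP]
    simp

end FastMatMulAlgorithm

/-! ### Choice of parameters and asymptotic bounds -/

theorem pow_le_two_pow_mul (n l : ℕ) : n ^ l ≤ 2 ^ (n * l) := by
  rw [pow_mul]
  exact Nat.pow_le_pow_left Nat.lt_two_pow_self.le l

namespace FastMatMulAlgorithm

variable {T r : ℕ}

/-- The circuit for suitable numbers of digits, with bounds on its size and depth in terms of the
number `l` of levels of the recursion. -/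
theorem exists_circuit_bound (hT : 0 < T) (alg : FastMatMulAlgorithm T r) (β : ℕ) :
    ∃ κ : ℕ, ∀ d l b : ℕ, 1 ≤ d → 1 ≤ l → b ≤ β * l →
      ∃ (m : ℕ) (C : ThresholdCircuit (MatrixBits (T ^ l) b ⊕ MatrixBits (T ^ l) b)
          (MatrixBits (T ^ l) m)),
        C.ComputesMatrixProduct ∧ m ≤ κ * l ∧ C.depth ≤ κ * d ∧
        C.size ≤ κ * (l ^ 2 * (r ^ l * (d * 2 ^ (l / d)))) := by
  -- The factors get `μ * l` bits and the entries `ν * l`. Crude bounds suffice, as only linearity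
  -- in `l` matters; the `3` beats the additive `2` in the exponents, since `l ≥ 1`.
  obtain ⟨μ, hμ⟩ : ∃ μ, μ = 2 * T + 2 * β + 3 := ⟨_, rfl⟩
  obtain ⟨ν, hν⟩ : ∃ ν, ν = r + 4 * μ + 3 := ⟨_, rfl⟩
  -- The three terms count factors, conjunctions and entries. The final `3` absorbs the three layers
  -- beyond the `(μ + ν) * d` digit layers.
  refine ⟨12 * μ + 4 * μ ^ 2 + 6 * ν + 3, fun d l b hd hl hb => ?_⟩
  -- With `l / d + 1` bits per digit, `a * d` digits cover `a * l` bits.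
  have hchunks : ∀ a, a * l ≤ (l / d + 1) * (a * d) := fun a => by
    have h : l ≤ d * (l / d + 1) := (Nat.lt_mul_div_succ l hd).le
    calc a * l ≤ a * (d * (l / d + 1)) := Nat.mul_le_mul_left a h
      _ = _ := by ring
  have hfactor : Fintype.card (MatrixBits (T ^ l) b ⊕ MatrixBits (T ^ l) b) * 2 ^ b <
      2 ^ (μ * l) := by
    have hcard : Fintype.card (MatrixBits (T ^ l) b ⊕ MatrixBits (T ^ l) b) =
        4 * (T ^ l * T ^ l * b) := by
      simp only [MatrixBits, Fintype.card_sum, Fintype.card_prod, Fintype.card_fin,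
        Fintype.card_bool]
      ring
    rw [hcard]
    calc 4 * (T ^ l * T ^ l * b) * 2 ^ b
        ≤ 2 ^ 2 * (2 ^ (T * l) * 2 ^ (T * l) * 2 ^ b) * 2 ^ b := by
          have := pow_le_two_pow_mul T l
          have := (Nat.lt_two_pow_self (n := b)).le
          gcongr
          norm_num
      _ = 2 ^ (2 + (T * l + T * l + b) + b) := by simp only [pow_add]
      _ < 2 ^ (μ * l) := by
          refine Nat.pow_lt_pow_right one_lt_two ?_
          rw [hμ]
          nlinarith
  have hproduct : r ^ l * (2 * (μ * l) * (2 * (μ * l))) * 2 ^ (μ * l + μ * l) < 2 ^ (ν * l) := by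
    calc r ^ l * (2 * (μ * l) * (2 * (μ * l))) * 2 ^ (μ * l + μ * l)
        ≤ 2 ^ (r * l) * (2 ^ 1 * 2 ^ (μ * l) * (2 ^ 1 * 2 ^ (μ * l))) * 2 ^ (μ * l + μ * l) := by
          have := pow_le_two_pow_mul r l
          have := (Nat.lt_two_pow_self (n := μ * l)).le
          gcongr <;> norm_num
      _ = 2 ^ (r * l + (1 + μ * l + (1 + μ * l)) + (μ * l + μ * l)) := by simp only [pow_add]
      _ < 2 ^ (ν * l) := by
          refine Nat.pow_lt_pow_right one_lt_two ?_
          rw [hν]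
          nlinarith
  obtain ⟨C, hC, hlayers, hsize⟩ := alg.exists_circuit l b (μ * d) (l / d + 1) (μ * l)
    (ν * d) (l / d + 1) (ν * l) (hchunks μ) (hchunks ν) hfactor hproduct
  refine ⟨ν * l, C, hC, Nat.mul_le_mul_right l (by omega), hlayers.depth_le.trans ?_, ?_⟩
  · nlinarith [Nat.zero_le (μ * d), Nat.zero_le (ν * d), Nat.zero_le (μ ^ 2 * d)]
  · rw [hsize]
    obtain ⟨X, hX⟩ : ∃ X, X = d * 2 ^ (l / d) := ⟨_, rfl⟩
    have hX1 : 1 ≤ X := hX ▸ Nat.mul_pos hd (by positivity)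
    have hform : ∀ a, a * d * 2 ^ (l / d + 1) + a * l ≤ 3 * a * (l ^ 2 * X) := fun a => by
      have h1 : X ≤ l ^ 2 * X := Nat.le_mul_of_pos_left _ (by positivity)
      have h2 : l ≤ l ^ 2 * X := (Nat.le_self_pow two_ne_zero l).trans
        (Nat.le_mul_of_pos_right _ hX1)
      calc a * d * 2 ^ (l / d + 1) + a * l = 2 * a * X + a * l := by rw [hX]; ring
        _ ≤ 2 * a * (l ^ 2 * X) + a * (l ^ 2 * X) := by gcongr
        _ = _ := by ring
    have hsq : T ^ l * T ^ l ≤ r ^ l := by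
      rw [← mul_pow, ← sq]
      exact Nat.pow_le_pow_left (alg.sq_le hT) l
    calc 2 * (r ^ l + r ^ l) * (μ * d * 2 ^ (l / d + 1) + μ * l) +
          r ^ l * (2 * (μ * l) * (2 * (μ * l))) +
          2 * (T ^ l * T ^ l) * (ν * d * 2 ^ (l / d + 1) + ν * l)
        ≤ 2 * (r ^ l + r ^ l) * (3 * μ * (l ^ 2 * X)) +
          r ^ l * (2 * (μ * l) * (2 * (μ * l))) * X + 2 * r ^ l * (3 * ν * (l ^ 2 * X)) := by
          refine Nat.add_le_add (Nat.add_le_add (Nat.mul_le_mul_left _ (hform μ))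
            (Nat.le_mul_of_pos_right _ hX1)) (Nat.mul_le_mul ?_ (hform ν))
          exact Nat.mul_le_mul_left 2 hsq
      _ = (12 * μ + 4 * μ ^ 2 + 6 * ν) * (l ^ 2 * (r ^ l * X)) := by ring
      _ ≤ (12 * μ + 4 * μ ^ 2 + 6 * ν + 3) * (l ^ 2 * (r ^ l * (d * 2 ^ (l / d)))) := by
          rw [hX]
          exact Nat.mul_le_mul_right _ (Nat.le_add_right _ _)

/-- The number of multiplications of the recursive algorithm as a power of the dimension. -/
theorem pow_rpow_exponent (hT : 2 ≤ T) (alg : FastMatMulAlgorithm T r) (l : ℕ) :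
    ((T ^ l : ℕ) : ℝ) ^ alg.exponent = (r : ℝ) ^ l := by
  have hr : 0 < r := (by positivity : 0 < T ^ 2).trans_le (alg.sq_le (by omega))
  have hT1 : (1 : ℝ) < T := by exact_mod_cast hT
  rw [Nat.cast_pow, ← Real.rpow_natCast, ← Real.rpow_mul (by positivity), mul_comm, Real.rpow_mul
    (by positivity), exponent, Real.rpow_logb (by positivity) hT1.ne' (by exact_mod_cast hr),
    Real.rpow_natCast]

end FastMatMulAlgorithm

theorem two_pow_div_le_rpow {T : ℕ} (hT : 2 ≤ T) (l d : ℕ) :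
    (2 : ℝ) ^ (l / d) ≤ ((T ^ l : ℕ) : ℝ) ^ (1 / (d : ℝ)) := by
  have hT2 : (2 : ℝ) ≤ T := by exact_mod_cast hT
  calc (2 : ℝ) ^ (l / d) ≤ (T : ℝ) ^ (l / d) := pow_le_pow_left₀ zero_le_two hT2 _
    _ = (T : ℝ) ^ ((l / d : ℕ) : ℝ) := (Real.rpow_natCast _ _).symm
    _ ≤ (T : ℝ) ^ ((l : ℝ) * (1 / d)) := by
        refine Real.rpow_le_rpow_of_exponent_le (by linarith) ?_
        rw [mul_one_div]
        exact Nat.cast_div_le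
    _ = _ := by rw [Real.rpow_mul (by positivity), Real.rpow_natCast, Nat.cast_pow]

theorem mainTheorem5 (T r : ℕ) (hT : 2 ≤ T) (alg : FastMatMulAlgorithm T r) (c : ℝ) :
    ∃ (K : ℝ) (k : ℕ), ∀ (d l N b : ℕ), 1 ≤ d → 1 ≤ l → N = T ^ l →
      (b : ℝ) ≤ c * Real.log N →
      ∃ (m : ℕ) (C : ThresholdCircuit (MatrixBits N b ⊕ MatrixBits N b) (MatrixBits N m)),
        C.ComputesMatrixProduct ∧
        (m : ℝ) ≤ K * Real.log N ∧
        (C.depth : ℝ) ≤ K * d ∧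
        (C.size : ℝ) ≤
          K * Real.log N ^ k * (d * (N : ℝ) ^ (alg.exponent + 1 / (d : ℝ))) := by
  -- Here `c * log N = (c * log T) * l`; the natural ceiling also covers negative `c`.
  obtain ⟨κ, hκ⟩ := alg.exists_circuit_bound (by omega) ⌈c * Real.log T⌉₊
  have hlogT : 0 < Real.log T := Real.log_pos (by exact_mod_cast hT)
  -- The summands serve the depth, the bit length and the size respectively; dividing by `log T`
  -- turns `log N` into `l`.
  refine ⟨κ * (1 + 1 / Real.log T + 1 / Real.log T ^ 2), 2, ?_⟩
  rintro d l N b hd hl rfl hb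
  have hlog : Real.log (T ^ l : ℕ) = l * Real.log T := by rw [Nat.cast_pow, Real.log_pow]
  have hb' : b ≤ ⌈c * Real.log T⌉₊ * l := by
    rw [hlog] at hb
    have : (b : ℝ) ≤ ⌈c * Real.log T⌉₊ * l :=
      calc (b : ℝ) ≤ c * Real.log T * l := by linarith
        _ ≤ _ := by gcongr; exact Nat.le_ceil _
    exact_mod_cast this
  obtain ⟨m, C, hC, hm, hdepth, hsize⟩ := hκ d l b hd hl hb'
  have h1 : 0 ≤ 1 / Real.log T := by positivity
  have h2 : 0 ≤ 1 / Real.log T ^ 2 := by positivity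
  refine ⟨m, C, hC, ?_, ?_, ?_⟩
  · calc (m : ℝ) ≤ κ * l := by exact_mod_cast hm
      _ = κ * (1 / Real.log T) * (l * Real.log T) := by field_simp
      _ ≤ _ := by
        rw [hlog]
        gcongr
        linarith
  · calc (C.depth : ℝ) ≤ κ * 1 * d := by rw [mul_one]; exact_mod_cast hdepth
      _ ≤ _ := by
        gcongr
        linarith
  · have hN : (0 : ℝ) < (T ^ l : ℕ) := by
      have : 0 < T ^ l := by positivity
      exact_mod_cast this
    calc (C.size : ℝ) ≤ κ * ((l : ℝ) ^ 2 * ((r : ℝ) ^ l * (d * 2 ^ (l / d)))) := by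
          exact_mod_cast hsize
      _ ≤ κ * ((l : ℝ) ^ 2 * ((r : ℝ) ^ l * (d * ((T ^ l : ℕ) : ℝ) ^ (1 / (d : ℝ))))) := by
          gcongr
          exact two_pow_div_le_rpow hT l d
      _ = κ * (1 / Real.log T ^ 2) * (l * Real.log T) ^ 2 *
          (d * ((T ^ l : ℕ) : ℝ) ^ (alg.exponent + 1 / (d : ℝ))) := by
          rw [Real.rpow_add hN, alg.pow_rpow_exponent hT]
          field_simp
      _ ≤ _ := by
          rw [hlog]
          gcongr
          linarith
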